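/- For a topological space $X$ let $\mathcal C(X)$ be the set of continuous maps $X\to X$ with the compact-open topology, and let $\mathcal W(2;X)=\{g\circ g : g\in\mathcal C(X)\}$. Let $m\ge 1$ and equip $\mathbb R^m$ with the metric of the norm $\|x\|_\infty=\max_i|x_i|$. If $X$ is a metric space with metric $d$ and $(M_j)_{j\ge1}$ is a sequence of compact subsets of $X$ such that $X=\bigcup_j M_j$ and every compact subset of $X$ is contained in the union of finitely many $M_j$, put $$D(f,g)=\sum_{j=1}^{\infty}\min\Big\{\tfrac1{2^j},\ \sup_{x\in M_j} d(f(x),g(x))\Big\},\qquad f,g\in\mathcal C(X),$$ with the supremum read as $0$ if $M_j=\emptyset$; this is a metric that induces the compact-open topology of $\mathcal C(X)$. Write $B_\epsilon(h)=\{f\in\mathcal C(X): D(f,h)<\epsilon\}$. Theorem. (1) For every such sequence $(M_j)$ in $\mathbb R^m$, every $h\in\mathcal C(\mathbb R^m)$ and every $\epsilon>0$, the ball $B_\epsilon(h)$ contains a map $f$ that has no iterative square root, not even a discontinuous one: there is no map $g:\mathbb R^m\to\mathbb R^m$, continuous or not, with $g\circ g=f$. In particular, $\mathcal W(2;\mathbb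 R^m)$ contains no ball $B_\epsilon(h)$ with $\epsilon>0$. (2) Let $X$ be a topological space homeomorphic to $\mathbb R^m$. Then every open neighbourhood of every $h\in\mathcal C(X)$ contains a map $f\in\mathcal C(X)$ for which there is no map $g:X\to X$, continuous or not, with $g\circ g=f$. In particular, $\mathcal W(2;X)$ contains no non-empty open subset of $\mathcal C(X)$. (3) Let $X$ be a metric space homeomorphic to $\mathbb R^m$. Then for every sequence $(M_j)$ in $X$ as above, every ball $B_\epsilon(h)$ with $h\in\mathcal C(X)$ and $\epsilon>0$ contains a map $f$ for which there is no map $g:X\to X$, continuous or not, with $g\circ g=f$, and $\mathcal W(2;X)$ contains no ball $B_\epsilon(h)$ with $\epsilon>0$. -/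

import Mathlib

open Set Filter Topology

universe u

namespace SelfMap

/-- The set `W(n; X)` of the `n`-th iterates of the continuous self-maps of `X`, as a subset of
the space `C(X, X)` of all continuous self-maps. -/
def iteratePowers (n : ℕ) (X : Type*) [TopologicalSpace X] : Set C(X, X) :=
  {f | ∃ g : C(X, X), (g : X → X)^[n] = f}

/-- A sequence of compact sets that covers `X` and is such that every compact subset of `X` lies
in the union of finitely many of them. -/
structure IsCompactCover {X : Type*} [TopologicalSpace X] (M : ℕ → Set X) : Prop where
  isCompact : ∀ j, IsCompact (M j)
  iUnion_eq : ⋃ j, M j = univ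
  finite_cover : ∀ K : Set X, IsCompact K → ∃ s : Finset ℕ, K ⊆ ⋃ j ∈ s, M j

/-- `ρ_K(f, g) = sup {d(f x, g x) : x ∈ K}`. -/
noncomputable def supDistOn {X : Type*} [MetricSpace X] (K : Set X) (f g : C(X, X)) : ℝ :=
  sSup ((fun x => dist (f x) (g x)) '' K)

/-- `D(f, g) = ∑_{j ≥ 1} min {2⁻ʲ, ρ_{M_j}(f, g)}`. The sequence `M` is indexed from `0`, so the
set with index `j` here is `M_{j + 1}` and carries the weight `2⁻⁽ʲ⁺¹⁾`. -/
noncomputable def compactOpenDist {X : Type*} [MetricSpace X] (M : ℕ → Set X)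
    (f g : C(X, X)) : ℝ :=
  ∑' j : ℕ, min ((1 / 2 : ℝ) ^ (j + 1)) (supDistOn (M j) f g)

/-- The open ball of radius `ε` around `h` for `D`. -/
def compactOpenBall {X : Type*} [MetricSpace X] (M : ℕ → Set X) (h : C(X, X)) (ε : ℝ) :
    Set C(X, X) :=
  {f | compactOpenDist M f h < ε}

section Metrization

theorem supDistOn_nonneg {X : Type*} [MetricSpace X] (K : Set X) (f g : C(X, X)) :
    0 ≤ supDistOn K f g := by
  apply Real.sSup_nonneg
  rintro _ ⟨x, -, rfl⟩
  exact dist_nonneg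

theorem dist_le_supDistOn {X : Type*} [MetricSpace X] {K : Set X} (hK : IsCompact K)
    (f g : C(X, X)) {x : X} (hx : x ∈ K) : dist (f x) (g x) ≤ supDistOn K f g :=
  le_csSup (hK.image (by fun_prop)).bddAbove (mem_image_of_mem _ hx)

theorem supDistOn_le {X : Type*} [MetricSpace X] {K : Set X} {f g : C(X, X)} {r : ℝ}
    (hr : 0 ≤ r) (h : ∀ x ∈ K, dist (f x) (g x) ≤ r) : supDistOn K f g ≤ r := by
  apply Real.sSup_le _ hr
  rintro _ ⟨x, hx, rfl⟩
  exact h x hx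

theorem summable_compactOpenDist {X : Type*} [MetricSpace X] (M : ℕ → Set X) (f g : C(X, X)) :
    Summable fun j : ℕ => min ((1 / 2 : ℝ) ^ (j + 1)) (supDistOn (M j) f g) := by
  refine Summable.of_nonneg_of_le (fun j => le_min (by positivity) (supDistOn_nonneg _ _ _))
    (fun j => min_le_left _ _) ?_
  simp only [pow_succ]
  exact summable_geometric_two.mul_right (1 / 2)

theorem min_le_compactOpenDist {X : Type*} [MetricSpace X] (M : ℕ → Set X) (f g : C(X, X))
    (j : ℕ) : min ((1 / 2 : ℝ) ^ (j + 1)) (supDistOn (M j) f g) ≤ compactOpenDist M f g :=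
  (summable_compactOpenDist M f g).le_tsum j
    (fun i _ => le_min (by positivity) (supDistOn_nonneg _ _ _))

theorem compactOpenDist_le_add {X : Type*} [MetricSpace X] (M : ℕ → Set X) (f g : C(X, X))
    (n : ℕ) {r : ℝ} (hr : 0 ≤ r) (h : ∀ j < n, ∀ x ∈ M j, dist (f x) (g x) ≤ r) :
    compactOpenDist M f g ≤ n * r + (1 / 2) ^ n := by
  have hs := summable_compactOpenDist M f g
  have hg : HasSum (fun j : ℕ => (1 / 2 : ℝ) ^ (j + n + 1)) ((1 / 2) ^ n) := by
    have := hasSum_geometric_two.mul_left ((1 / 2 : ℝ) ^ (n + 1))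
    have e1 : (1 / 2 : ℝ) ^ (n + 1) * 2 = (1 / 2) ^ n := by rw [pow_succ, mul_assoc]; norm_num
    have e2 : (fun j : ℕ => (1 / 2 : ℝ) ^ (n + 1) * (1 / 2) ^ j) =
        fun j : ℕ => (1 / 2 : ℝ) ^ (j + n + 1) := by
      funext j
      rw [← pow_add]
      congr 1
      omega
    rwa [e1, e2] at this
  rw [compactOpenDist, ← hs.sum_add_tsum_nat_add n]
  refine add_le_add ?_ ?_
  · calc _ ≤ ∑ _i ∈ Finset.range n, r := Finset.sum_le_sum fun j hj =>
          (min_le_right _ _).trans (supDistOn_le hr (h j (Finset.mem_range.1 hj)))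
      _ = n * r := by simp
  · rw [← hg.tsum_eq]
    exact ((summable_nat_add_iff n).2 hs).tsum_le_tsum (fun j => min_le_left _ _) hg.summable

/-- For a cover as above, `D` is a metric on `C(X, X)` which induces the compact-open topology. -/
theorem compactOpenDist_metrizes {X : Type*} [MetricSpace X] {M : ℕ → Set X}
    (hM : IsCompactCover M) :
    ∃ d : MetricSpace C(X, X),
      d.toUniformSpace.toTopologicalSpace = ContinuousMap.compactOpen ∧
      ∀ f g, d.dist f g = compactOpenDist M f g := by
  have hself : ∀ f : C(X, X), compactOpenDist M f f = 0 := fun f => by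
    have : ∀ j, min ((1 / 2 : ℝ) ^ (j + 1)) (supDistOn (M j) f f) = 0 := fun j => by
      have h0 : supDistOn (M j) f f = 0 :=
        le_antisymm (supDistOn_le le_rfl (by simp)) (supDistOn_nonneg _ _ _)
      rw [h0]
      exact min_eq_right (by positivity)
    simp only [compactOpenDist, this, tsum_zero]
  have hcomm : ∀ f g : C(X, X), compactOpenDist M f g = compactOpenDist M g f := fun f g => by
    simp only [compactOpenDist, supDistOn, dist_comm]
  have htri : ∀ f g k : C(X, X),
      compactOpenDist M f k ≤ compactOpenDist M f g + compactOpenDist M g k := fun f g k => by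
    have h1 := summable_compactOpenDist M f g
    have h2 := summable_compactOpenDist M g k
    rw [compactOpenDist, compactOpenDist, compactOpenDist, ← h1.tsum_add h2]
    refine (summable_compactOpenDist M f k).tsum_le_tsum (fun j => ?_) (h1.add h2)
    have hρ : supDistOn (M j) f k ≤ supDistOn (M j) f g + supDistOn (M j) g k :=
      supDistOn_le (add_nonneg (supDistOn_nonneg _ _ _) (supDistOn_nonneg _ _ _)) fun x hx =>
        (dist_triangle _ (g x) _).trans
          (add_le_add (dist_le_supDistOn (hM.isCompact j) f g hx)
            (dist_le_supDistOn (hM.isCompact j) g k hx))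
    have n1 := supDistOn_nonneg (M j) f g
    have n2 := supDistOn_nonneg (M j) g k
    have n3 : (0 : ℝ) ≤ (1 / 2 : ℝ) ^ (j + 1) := by positivity
    rcases le_total ((1 / 2 : ℝ) ^ (j + 1)) (supDistOn (M j) f g) with a | a <;>
    rcases le_total ((1 / 2 : ℝ) ^ (j + 1)) (supDistOn (M j) g k) with b | b
    · rw [min_eq_left a, min_eq_left b]; exact (min_le_left _ _).trans (by linarith)
    · rw [min_eq_left a, min_eq_right b]; exact (min_le_left _ _).trans (by linarith)
    · rw [min_eq_right a, min_eq_left b]; exact (min_le_left _ _).trans (by linarith)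
    · rw [min_eq_right a, min_eq_right b]; exact (min_le_right _ _).trans hρ
  have hopen : ∀ s : Set C(X, X),
      IsOpen s ↔ ∀ f ∈ s, ∃ ε > 0, ∀ g, compactOpenDist M f g < ε → g ∈ s := fun s => by
    rw [isOpen_iff_mem_nhds]
    refine forall₂_congr fun f _ => ?_
    have hb := nhds_basis_uniformity'
      (Metric.uniformity_basis_dist (α := X)).compactConvergenceUniformity (x := f)
    rw [hb.mem_iff]
    constructor
    · rintro ⟨⟨K, r⟩, ⟨hK, hr⟩, hsub⟩
      obtain ⟨t, ht⟩ := hM.finite_cover K hK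
      have hr : (0 : ℝ) < r := hr
      obtain ⟨n, hn⟩ := t.exists_nat_subset_range
      refine ⟨min r ((1 / 2) ^ n), lt_min hr (by positivity), fun g hg => hsub ?_⟩
      intro x hx
      obtain ⟨j, hj, hxj⟩ := mem_iUnion₂.1 (ht hx)
      have hjn : j + 1 ≤ n := Finset.mem_range.1 (hn hj)
      have h1 := (min_le_compactOpenDist M f g j).trans_lt hg
      have h2 : ((1 / 2 : ℝ)) ^ n ≤ (1 / 2) ^ (j + 1) :=
        pow_le_pow_of_le_one (by norm_num) (by norm_num) hjn
      have h3 := dist_le_supDistOn (hM.isCompact j) f g hxj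
      rcases min_lt_iff.1 h1 with h | h
      · exact absurd (h.trans_le (min_le_right _ _)) (not_lt.2 h2)
      · exact h3.trans_lt (h.trans_le (min_le_left _ _))
    · rintro ⟨ε, hε, hsub⟩
      obtain ⟨n, hn⟩ := exists_pow_lt_of_lt_one (half_pos hε) (by norm_num : (1 / 2 : ℝ) < 1)
      refine ⟨(⋃ j ∈ Finset.range n, M j, ε / (2 * (n + 1))),
        ⟨(Finset.range n).isCompact_biUnion fun j _ => hM.isCompact j, by positivity⟩,
        fun g hg => hsub g ?_⟩
      have hle := compactOpenDist_le_add M f g n (r := ε / (2 * (n + 1))) (by positivity)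
        fun j hj x hx => (hg x (mem_iUnion₂.2 ⟨j, Finset.mem_range.2 hj, hx⟩)).le
      have : (n : ℝ) * (ε / (2 * (n + 1))) ≤ ε / 2 := by
        rw [mul_div_assoc', div_le_div_iff₀ (by positivity) (by norm_num)]
        nlinarith
      linarith
  let p := PseudoMetricSpace.ofDistTopology (compactOpenDist M) hself hcomm htri hopen
  refine ⟨{ p with eq_of_dist_eq_zero := ?_ }, rfl, fun _ _ => rfl⟩
  intro f g hfg
  replace hfg : compactOpenDist M f g = 0 := hfg
  ext x
  obtain ⟨j, hj⟩ := mem_iUnion.1 (hM.iUnion_eq ▸ mem_univ x : x ∈ ⋃ j, M j)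
  have h1 := hfg ▸ min_le_compactOpenDist M f g j
  have h2 := dist_le_supDistOn (hM.isCompact j) f g hj
  rcases min_le_iff.1 h1 with h | h
  · exact absurd h (not_le.2 (by positivity))
  · exact dist_le_zero.1 (h2.trans h)

end Metrization

end SelfMap

namespace SelfMap

/-! ### An obstruction to square roots from the sizes of fibres. -/

section Combinatorial

/-! The obstruction is set-theoretic. A root `g` of `f` commutes with `f`. If `x₀` is not fixed by
`f`, then `g` moves `x₀` and carries the second preimage of `x₀` into that of `g x₀`, along a path
that avoids `x₀`. If only the fibre over `x₀` may be infinite, the target is finite and `g` is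
finite-to-one on the source, so the second preimage of `x₀` cannot be infinite.

Maps with this obstruction are dense. By Stone–Weierstrass, `h` is close on a compact set to a
polynomial map; adding a small multiple of `x i ^ N`, with `N` above all degrees, gives a map `F`
with finite fibres and finitely many fixed points (`finite_of_pow_eq_eval`). Precomposing `F` with a
map that collapses a small ball to its centre `a` makes one fibre infinite, the one over `x₀ = F a`.
With `a` in the image of `F`, a whole open set is sent into that ball, so the second preimage of
`x₀` is infinite too. Conjugation by a homeomorphism transfers the result to `X`. -/

/-- A self-map has no square root, continuous or not, if some point that is not fixed has an
infinite second preimage while every other point has a finite preimage. -/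
theorem not_exists_iterate_two_eq {X : Type*} {f : X → X} {x₀ : X} (hfix : f x₀ ≠ x₀)
    (hfin : ∀ y ≠ x₀, (f ⁻¹' {y}).Finite) (hinf : {x | f (f x) = x₀}.Infinite) :
    ¬ ∃ g : X → X, g^[2] = f := by
  rintro ⟨g, hg⟩
  have hgg : ∀ x, g (g x) = f x := fun x => by rw [← hg]; rfl
  have hgf : ∀ x, g (f x) = f (g x) := fun x => by rw [← hgg, ← hgg]
  have hg₀ : g x₀ ≠ x₀ := fun h => hfix (by rw [← hgg, h, h])
  -- By commutation `g b` lies in the second preimage of `g x₀`. Its first image `f (g b)` is not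
  -- `x₀`, since otherwise `x₀ = f (f b) = g (f (g b)) = g x₀`.
  have hmaps : MapsTo g {x | f (f x) = x₀} (⋃ y ∈ f ⁻¹' {g x₀} \ {x₀}, f ⁻¹' {y}) := by
    intro b hb
    have hb : f (f b) = x₀ := hb
    refine mem_iUnion₂.2 ⟨f (g b), ⟨?_, ?_⟩, rfl⟩
    · change f (f (g b)) = g x₀
      rw [← hgf, ← hgf, hb]
    · intro h
      have h : f (g b) = x₀ := h
      have h1 : f (f b) = g x₀ := by rw [← h, hgf, hgg]
      exact hg₀ (h1.symm.trans hb)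
  have hfin' : (⋃ y ∈ f ⁻¹' {g x₀} \ {x₀}, f ⁻¹' {y}).Finite :=
    (((hfin _ hg₀).subset sdiff_subset).biUnion fun y hy => hfin y hy.2)
  refine hinf ((hfin'.biUnion (t := fun z => {b | f (f b) = x₀} ∩ g ⁻¹' {z}) fun z _ => ?_).subset
    fun b hb => mem_biUnion (hmaps hb) ⟨hb, rfl⟩)
  -- If `g b = z`, then `f b = g z`. The value `x₀` is excluded, as it would give `f x₀ = f (f b) =
  -- x₀`; any other value has a finite fibre.
  by_cases h : g z = x₀
  · convert finite_empty
    refine eq_empty_of_forall_notMem fun b ⟨hb, hbz⟩ => hfix ?_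
    have hb : f (f b) = x₀ := hb
    have hbz : g b = z := hbz
    rw [← hbz, hgg] at h
    rwa [h] at hb
  · refine (hfin _ h).subset fun x ⟨_, hx⟩ => ?_
    have hx : g x = z := hx
    change f x = g z
    rw [← hgg, hx]

end Combinatorial

/-! ### Finite fibres of polynomial maps with dominant pure powers. -/

section FiniteFibers

/-- A set on which the `N`-th power of each coordinate agrees with a polynomial of total degree
less than `N` is finite. -/
theorem finite_of_pow_eq_eval {σ K : Type*} [Fintype σ] [Field K] {S : Set (σ → K)} {N : ℕ}
    {q : σ → MvPolynomial σ K} (hq : ∀ i, (q i).totalDegree < N)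
    (hS : ∀ x ∈ S, ∀ i, x i ^ N = MvPolynomial.eval x (q i)) : S.Finite := by
  classical
  -- The image of `φ` is the algebra of polynomial functions on `S`. It is shown to be
  -- finite-dimensional, so each coordinate function is integral over `K` and takes only finitely
  -- many values, the roots of a monic polynomial.
  let φ : MvPolynomial σ K →ₐ[K] (S → K) := MvPolynomial.aeval fun i x => x.1 i
  have hφ : ∀ (p : MvPolynomial σ K) (x : S), φ p x = MvPolynomial.eval x.1 p := fun p x => by
    have : ((Pi.evalAlgHom K (fun _ : S => K) x).comp φ) = MvPolynomial.aeval x.1 := by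
      ext i
      simp [φ]
    have := DFunLike.congr_fun this p
    simpa [MvPolynomial.aeval_eq_eval] using this
  have hpow : ∀ i, φ (MvPolynomial.X i ^ N) = φ (q i) := fun i => by
    funext x
    rw [hφ, hφ, ← hS x.1 x.2 i]
    simp
  let B : Set (σ →₀ ℕ) := {s | ∀ i, s i < N}
  have hB : B.Finite := (Set.finite_Icc 0 (Finsupp.equivFunOnFinite.symm fun _ => N)).subset
    fun s hs => ⟨zero_le, fun i => (hs i).le⟩
  let V : Submodule K (S → K) := Submodule.span K ((fun s => φ (MvPolynomial.monomial s 1)) '' B)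
  have hV : ∀ (d : ℕ) (p : MvPolynomial σ K), p.totalDegree < d → φ p ∈ V := by
    intro d
    induction d with
    | zero => exact fun p hp => absurd hp (Nat.not_lt_zero _)
    | succ d ih =>
      intro p hp
      rw [p.as_sum, map_sum]
      refine V.sum_mem fun s hs => ?_
      have hsd := (MvPolynomial.le_totalDegree hs).trans (Nat.lt_succ_iff.1 hp)
      rw [show MvPolynomial.monomial s (p.coeff s) = p.coeff s • MvPolynomial.monomial s 1 by
        rw [MvPolynomial.smul_monomial, smul_eq_mul, mul_one], map_smul]
      refine V.smul_mem _ ?_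
      by_cases hsB : s ∈ B
      · exact Submodule.subset_span ⟨s, hsB, rfl⟩
      -- Replacing the factor `X i ^ N` by `q i` does not change the function on `S` and strictly
      -- lowers the degree.
      · obtain ⟨i, hi⟩ : ∃ i, N ≤ s i := by simpa [B] using hsB
        obtain ⟨s', rfl⟩ : ∃ s', s = s' + Finsupp.single i N :=
          ⟨s - Finsupp.single i N, (tsub_add_cancel_of_le (Finsupp.single_le_iff.2 hi)).symm⟩
        rw [MvPolynomial.monomial_add_single, map_mul, hpow, ← map_mul]
        refine ih _ ((MvPolynomial.totalDegree_mul _ _).trans_lt ?_)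
        rw [MvPolynomial.totalDegree_monomial _ one_ne_zero]
        rw [Finsupp.sum_add_index' (fun _ => rfl) (fun _ _ _ => rfl),
          Finsupp.sum_single_index rfl] at hsd
        have := hq i
        omega
  have hfg : (Subalgebra.toSubmodule φ.range).FG := by
    have hle : Subalgebra.toSubmodule φ.range ≤ V := by
      rintro _ ⟨p, rfl⟩
      exact hV _ p (Nat.lt_succ_self _)
    have : FiniteDimensional K V := FiniteDimensional.span_of_finite K (hB.image _)
    exact (Submodule.fg_iff_finiteDimensional _).2 (Submodule.finiteDimensional_of_le hle)
  have hcoord : ∀ i, ((fun x : σ → K => x i) '' S).Finite := fun i => by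
    obtain ⟨P, hP, hP0⟩ := IsIntegral.of_mem_of_fg φ.range hfg (φ (MvPolynomial.X i)) ⟨_, rfl⟩
    refine (P.rootSet_finite K).subset ?_
    rintro _ ⟨x, hx, rfl⟩
    rw [Polynomial.mem_rootSet]
    refine ⟨hP.ne_zero, ?_⟩
    have := congr_fun hP0 ⟨x, hx⟩
    rw [← Polynomial.aeval_def] at this
    have h2 := Polynomial.aeval_algHom_apply (Pi.evalAlgHom K (fun _ : S => K) ⟨x, hx⟩)
      (φ (MvPolynomial.X i)) P
    rw [Pi.evalAlgHom_apply, Pi.evalAlgHom_apply, this, hφ] at h2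
    simpa using h2
  exact (Set.Finite.pi' hcoord).subset fun x hx i => ⟨x, hx, rfl⟩

/-- If the degree of `p` is less than `N` and `t ≠ 0`, then each fibre of `x ↦ p x + t x ^ N`
is finite. -/
theorem finite_setOf_eval_add_mul_pow_eq {σ K : Type*} [Fintype σ] [Field K] {N : ℕ} (hN : 0 < N)
    {p : σ → MvPolynomial σ K} (hp : ∀ i, (p i).totalDegree < N) {t : K} (ht : t ≠ 0)
    (y : σ → K) :
    {x : σ → K | ∀ i, MvPolynomial.eval x (p i) + t * x i ^ N = y i}.Finite := by
  refine finite_of_pow_eq_eval (N := N)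
    (q := fun i => MvPolynomial.C t⁻¹ * (MvPolynomial.C (y i) - p i)) (fun i => ?_) ?_
  · refine (MvPolynomial.totalDegree_mul _ _).trans_lt ?_
    rw [MvPolynomial.totalDegree_C, zero_add]
    refine (MvPolynomial.totalDegree_sub _ _).trans_lt ?_
    rw [MvPolynomial.totalDegree_C]
    exact max_lt hN (hp i)
  · intro x hx i
    have := hx i
    simp only [map_mul, map_sub, MvPolynomial.eval_C, ← this]
    field_simp
    ring

end FiniteFibers

/-! ### Density of the maps with finite fibres and finitely many fixed points. -/

section Approximation

theorem exists_compact_approx_subset {X Y : Type*} [TopologicalSpace X] [PseudoMetricSpace Y]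
    {h : C(X, Y)} {U : Set C(X, Y)} (hU : IsOpen U) (hh : h ∈ U) :
    ∃ K : Set X, IsCompact K ∧ ∃ ε > 0, ∀ f : C(X, Y), (∀ x ∈ K, dist (h x) (f x) < ε) → f ∈ U := by
  have hb := nhds_basis_uniformity'
    (Metric.uniformity_basis_dist (α := Y)).compactConvergenceUniformity (x := h)
  obtain ⟨⟨K, r⟩, ⟨hK, hr⟩, hsub⟩ := hb.mem_iff.1 (hU.mem_nhds hh)
  exact ⟨K, hK, r, hr, fun f hf => hsub fun x hx => hf x hx⟩

theorem exists_mvPolynomial_near {σ : Type*} [Fintype σ] (f : C(σ → ℝ, ℝ)) {K : Set (σ → ℝ)}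
    (hK : IsCompact K) {ε : ℝ} (hε : 0 < ε) :
    ∃ p : MvPolynomial σ ℝ, ∀ x ∈ K, |MvPolynomial.eval x p - f x| < ε := by
  let φ : MvPolynomial σ ℝ →ₐ[ℝ] C(σ → ℝ, ℝ) :=
    MvPolynomial.aeval fun i => ⟨fun x => x i, continuous_apply i⟩
  have hφ : ∀ (p : MvPolynomial σ ℝ) (x : σ → ℝ), φ p x = MvPolynomial.eval x p := fun p x => by
    induction p using MvPolynomial.induction_on with
    | C a => simp [φ]
    | add p q hp hq => simp [hp, hq]
    | mul_X p i hp => simp [hp]; simp [φ]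
  have hsep : φ.range.SeparatesPoints := by
    intro x y hxy
    obtain ⟨i, hi⟩ := Function.ne_iff.1 hxy
    exact ⟨_, ⟨φ (MvPolynomial.X i), ⟨_, rfl⟩, rfl⟩, by simpa [hφ] using hi⟩
  obtain ⟨_, ⟨p, rfl⟩, hp⟩ :=
    ContinuousMap.exists_mem_subalgebra_near_continuous_of_isCompact_of_separatesPoints hsep f hK hε
  refine ⟨p, fun x hx => ?_⟩
  rw [← hφ, ← Real.norm_eq_abs]
  exact hp x hx

/-- The self-maps of `ℝ^m` with finite fibres and finitely many fixed points are dense. -/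
theorem exists_finite_fibers_mem {σ : Type*} [Fintype σ] {h : C(σ → ℝ, σ → ℝ)}
    {U : Set C(σ → ℝ, σ → ℝ)} (hU : IsOpen U) (hh : h ∈ U) :
    ∃ F ∈ U, (∀ y, (F ⁻¹' {y}).Finite) ∧ {x | F x = x}.Finite := by
  obtain ⟨K, hK, ε, hε, hsub⟩ := exists_compact_approx_subset hU hh
  choose p hp using fun i => exists_mvPolynomial_near
    ((ContinuousMap.mk (fun x : σ → ℝ => x i) (continuous_apply i)).comp h) hK (half_pos hε)
  -- The summand 2 makes `N` exceed 1 as well, so that `p i - X i`, whose perturbation describes the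
  -- fixed points, also has degree below `N`.
  let N := (Finset.univ.sup fun i => (p i).totalDegree) + 2
  have hN : ∀ i, (p i).totalDegree < N := fun i =>
    (Finset.le_sup (f := fun i => (p i).totalDegree) (Finset.mem_univ i)).trans_lt (by simp [N])
  obtain ⟨R, hR⟩ := hK.isBounded.exists_norm_le
  -- The absolute value is needed because `R` may be negative when `K` is empty; the added 1 keeps
  -- the denominator positive and the bound strict.
  let t := ε / (2 * (|R| ^ N + 1))
  have ht : 0 < t := by positivity
  have htR : t * |R| ^ N < ε / 2 := by
    have hR0 : 0 ≤ |R| ^ N := by positivity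
    simp only [t]
    rw [div_mul_eq_mul_div, div_lt_div_iff₀ (by positivity) (by norm_num)]
    nlinarith
  refine ⟨⟨fun x i => MvPolynomial.eval x (p i) + t * x i ^ N, continuous_pi fun i =>
    ((MvPolynomial.continuous_eval (p i)).add (by fun_prop))⟩, hsub _ fun x hx => ?_,
    fun y => ?_, ?_⟩
  · rw [dist_pi_lt_iff hε]
    intro i
    have h1 := hp i x hx
    have h2 : |t * x i ^ N| ≤ t * |R| ^ N := by
      rw [abs_mul, abs_pow, abs_of_pos ht]
      refine mul_le_mul_of_nonneg_left (pow_le_pow_left₀ (abs_nonneg _) ?_ N) ht.le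
      exact (norm_le_pi_norm x i).trans ((hR x hx).trans (le_abs_self R))
    rw [dist_comm, Real.dist_eq]
    calc |MvPolynomial.eval x (p i) + t * x i ^ N - h x i|
        = |(MvPolynomial.eval x (p i) - h x i) + t * x i ^ N| := by ring_nf
      _ ≤ |MvPolynomial.eval x (p i) - h x i| + |t * x i ^ N| := abs_add_le _ _
      _ < ε / 2 + ε / 2 := add_lt_add h1 (h2.trans_lt htR)
      _ = ε := add_halves ε
  · refine (finite_setOf_eval_add_mul_pow_eq (by simp [N]) hN ht.ne' y).subset fun x hx i => ?_
    exact congr_fun hx i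
  · refine (finite_setOf_eval_add_mul_pow_eq (p := fun i => p i - MvPolynomial.X i) (N := N)
      (by simp [N]) (fun i => ?_) ht.ne' 0).subset fun x hx i => ?_
    · refine (MvPolynomial.totalDegree_sub _ _).trans_lt (max_lt (hN i) ?_)
      rw [MvPolynomial.totalDegree_X]
      simp [N]
    · have := congr_fun hx i
      simp only [ContinuousMap.coe_mk] at this
      simp only [map_sub, MvPolynomial.eval_X, Pi.zero_apply]
      linarith

end Approximation

/-! ### Collapsing a small ball to its centre. -/

section Collapse

variable {E : Type*} [NormedAddCommGroup E] [NormedSpace ℝ E]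

/-- The map which collapses the ball of radius `r` around `a` to its centre and moves every other
point by the distance `r` towards `a`. -/
noncomputable def collapse (a : E) {r : ℝ} (hr : 0 < r) : C(E, E) where
  toFun x := x - (r / max r ‖x - a‖) • (x - a)
  continuous_toFun := by
    have : ∀ x : E, max r ‖x - a‖ ≠ 0 := fun x => (lt_max_of_lt_left hr).ne'
    fun_prop (disch := assumption)

theorem collapse_apply (a : E) {r : ℝ} (hr : 0 < r) (x : E) :
    collapse a hr x = x - (r / max r ‖x - a‖) • (x - a) := rfl

theorem dist_collapse_le (a : E) {r : ℝ} (hr : 0 < r) (x : E) : dist x (collapse a hr x) ≤ r := by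
  have hm : 0 < max r ‖x - a‖ := lt_max_of_lt_left hr
  rw [dist_eq_norm, collapse_apply, sub_sub_cancel, norm_smul, Real.norm_of_nonneg (by positivity),
    div_mul_eq_mul_div, div_le_iff₀ hm]
  exact mul_le_mul_of_nonneg_left (le_max_right _ _) hr.le

theorem collapse_of_norm_le {a : E} {r : ℝ} (hr : 0 < r) {x : E} (hx : ‖x - a‖ ≤ r) :
    collapse a hr x = a := by
  rw [collapse_apply, max_eq_left hx, div_self hr.ne', one_smul, sub_sub_cancel]

theorem collapse_add_smul {a : E} {r : ℝ} (hr : 0 < r) {w : E} (hw : w ≠ 0) :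
    collapse a hr (a + (1 + r / ‖w‖) • w) = a + w := by
  have hw' : 0 < ‖w‖ := norm_pos_iff.2 hw
  have h1 : ‖(1 + r / ‖w‖) • w‖ = ‖w‖ + r := by
    rw [norm_smul, Real.norm_of_nonneg (by positivity)]
    field_simp
  rw [collapse_apply, add_sub_cancel_left, h1, max_eq_right (by linarith), smul_smul,
    add_sub_assoc, ← sub_smul]
  have h2 : 1 + r / ‖w‖ - r / (‖w‖ + r) * (1 + r / ‖w‖) = 1 := by
    field_simp
    ring
  rw [h2, one_smul]

/-- Outside the ball the collapse is a radial shift by `r`, hence invertible: a point is recovered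
from its image by pushing it outwards by `r`. So only the fibre over `a` can fail to be a single
point. -/
theorem eq_of_collapse_ne {a : E} {r : ℝ} (hr : 0 < r) {x : E} (hx : collapse a hr x ≠ a) :
    x = a + (1 + r / ‖collapse a hr x - a‖) • (collapse a hr x - a) := by
  have hxr : r < ‖x - a‖ := not_le.1 fun h => hx (collapse_of_norm_le hr h)
  have h0 : 0 < ‖x - a‖ := hr.trans hxr
  have h1 : collapse a hr x - a = (1 - r / ‖x - a‖) • (x - a) := by
    rw [collapse_apply, max_eq_right hxr.le, sub_smul, one_smul]
    abel
  have h2 : 0 < ‖x - a‖ - r := sub_pos.2 hxr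
  have h3 : 1 - r / ‖x - a‖ = (‖x - a‖ - r) / ‖x - a‖ := by field_simp
  have h4 : ‖(1 - r / ‖x - a‖) • (x - a)‖ = ‖x - a‖ - r := by
    rw [norm_smul, h3, Real.norm_of_nonneg (by positivity)]
    field_simp
  rw [h1, h4, smul_smul]
  have h5 : (1 + r / (‖x - a‖ - r)) * (1 - r / ‖x - a‖) = 1 := by
    rw [h3]
    field_simp
    ring
  rw [h5, one_smul, add_sub_cancel]

theorem collapse_surjective (a : E) {r : ℝ} (hr : 0 < r) : Function.Surjective (collapse a hr) := by
  intro y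
  by_cases hy : y = a
  · exact ⟨a, by rw [hy]; exact collapse_of_norm_le hr (by simpa using hr.le)⟩
  · exact ⟨_, (collapse_add_smul hr (sub_ne_zero.2 hy)).trans (add_sub_cancel _ _)⟩

theorem finite_preimage_collapse {a : E} {r : ℝ} (hr : 0 < r) {S : Set E} (hS : S.Finite)
    (ha : a ∉ S) : (collapse a hr ⁻¹' S).Finite := by
  refine hS.preimage fun x hx y hy hxy => ?_
  rw [eq_of_collapse_ne hr (ne_of_mem_of_not_mem hx ha),
    eq_of_collapse_ne hr (ne_of_mem_of_not_mem hy ha), hxy]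

theorem tendsto_collapse (a : E) :
    Tendsto (fun n : ℕ => collapse a (Nat.one_div_pos_of_nat (α := ℝ) (n := n))) atTop
      (𝓝 (ContinuousMap.id E)) := by
  refine ContinuousMap.tendsto_of_tendstoLocallyUniformly
    (TendstoUniformly.tendstoLocallyUniformly ?_)
  rw [Metric.tendstoUniformly_iff]
  intro ε hε
  filter_upwards [tendsto_one_div_add_atTop_nhds_zero_nat.eventually_lt_const hε] with n hn x
  exact (dist_collapse_le a _ x).trans_lt hn

end Collapse

/-! ### Maps without square roots are dense. -/

section Density

/-- Precomposition with a collapse around a suitable `a` stays in `U` for small radius and enlarges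
only the fibre over `F a`. -/
theorem exists_mem_not_exists_iterate_two_eq_of_finite_fibers {E : Type*} [NormedAddCommGroup E]
    [NormedSpace ℝ E] [Nontrivial E] {F : C(E, E)} (hfib : ∀ y, (F ⁻¹' {y}).Finite)
    (hfix : {x | F x = x}.Finite) {U : Set C(E, E)} (hU : IsOpen U) (hF : F ∈ U) :
    ∃ f ∈ U, ¬ ∃ g : E → E, g^[2] = f := by
  -- Otherwise the whole space would be the second preimage under `F` of its finite fixed-point set,
  -- hence finite.
  obtain ⟨b, hb⟩ : ∃ b, F (F (F b)) ≠ F (F b) := by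
    by_contra! hcon
    have := Module.punctured_nhds_neBot ℝ E (0 : E)
    refine infinite_of_mem_nhds (0 : E) univ_mem ?_
    exact ((hfix.preimage' fun y _ => hfib y).preimage' fun y _ => hfib y).subset
      fun x _ => hcon x
  set a := F b
  set x₀ := F a
  -- Since `F` moves `x₀`, so does every map near `F`, in particular the collapsed map for small
  -- radius.
  have hV : IsOpen {f : C(E, E) | f x₀ ≠ x₀} :=
    isOpen_ne.preimage (continuous_eval_const x₀)
  have hlim := (ContinuousMap.continuous_postcomp F).tendsto (ContinuousMap.id E) |>.comp
    (tendsto_collapse a)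
  rw [ContinuousMap.comp_id] at hlim
  obtain ⟨n, hnU, hnV⟩ := (hlim.eventually ((hU.inter hV).mem_nhds ⟨hF, hb⟩)).exists
  have hr : 0 < 1 / ((n : ℝ) + 1) := Nat.one_div_pos_of_nat
  refine ⟨F.comp (collapse a hr), hnU, not_exists_iterate_two_eq (x₀ := x₀) hnV (fun y hy => ?_) ?_⟩
  · exact finite_preimage_collapse hr (hfib y) fun h => hy (Eq.symm h)
  -- The new map sends `c` to `a`, hence a neighbourhood of `c` into the collapsed ball, and then to
  -- `x₀`.
  · obtain ⟨c, hc⟩ := collapse_surjective a hr b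
    have := Module.punctured_nhds_neBot ℝ E c
    have hcont : Continuous fun x => F (collapse a hr x) := by fun_prop
    have hca : F (collapse a hr c) = a := by rw [hc]
    refine infinite_of_mem_nhds c (mem_of_superset (hcont.continuousAt.preimage_mem_nhds
      (Metric.closedBall_mem_nhds _ hr)) fun x hx => ?_)
    rw [hca] at hx
    have hx : ‖F (collapse a hr x) - a‖ ≤ _ := mem_closedBall_iff_norm.1 hx
    change F (collapse a hr (F (collapse a hr x))) = x₀
    rw [collapse_of_norm_le hr hx]

/-- In a space homeomorphic to `ℝ^m` with `m ≥ 1` the self-maps without a square root are dense in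
the compact-open topology. -/
theorem exists_mem_not_exists_iterate_two_eq {m : ℕ} (hm : 1 ≤ m) {X : Type*} [TopologicalSpace X]
    (e : X ≃ₜ (Fin m → ℝ)) {h : C(X, X)} {U : Set C(X, X)} (hU : IsOpen U) (hh : h ∈ U) :
    ∃ f ∈ U, ¬ ∃ g : X → X, g^[2] = f := by
  have : NeZero m := ⟨by omega⟩
  -- Conjugation by `e` pulls `U` back to an open set and carries arbitrary square roots to square
  -- roots.
  let Φ : C(Fin m → ℝ, Fin m → ℝ) → C(X, X) := fun f =>
    (e.symm : C(Fin m → ℝ, X)).comp (f.comp (e : C(X, Fin m → ℝ)))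
  have hΦ : Continuous Φ := (ContinuousMap.continuous_postcomp _).comp
    (ContinuousMap.continuous_precomp _)
  have hh' : (e : C(X, Fin m → ℝ)).comp (h.comp (e.symm : C(Fin m → ℝ, X))) ∈ Φ ⁻¹' U := by
    change Φ _ ∈ U
    convert hh
    ext x
    simp [Φ]
  obtain ⟨F, hFU, hfib, hfix⟩ := exists_finite_fibers_mem (hU.preimage hΦ) hh'
  obtain ⟨f, hfU, hf⟩ := exists_mem_not_exists_iterate_two_eq_of_finite_fibers hfib hfix
    (hU.preimage hΦ) hFU
  refine ⟨Φ f, hfU, fun ⟨g, hg⟩ => hf ⟨e ∘ g ∘ e.symm, ?_⟩⟩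
  funext x
  have := congr_fun hg (e.symm x)
  simp only [Function.iterate_succ, Function.iterate_zero, Function.comp_apply, id] at this ⊢
  simp [this, Φ]

theorem isOpen_compactOpenBall {X : Type*} [MetricSpace X] {M : ℕ → Set X} (hM : IsCompactCover M)
    (h : C(X, X)) (ε : ℝ) : IsOpen (compactOpenBall M h ε) := by
  obtain ⟨d, hd, hdist⟩ := compactOpenDist_metrizes hM
  rw [← hd]
  convert @Metric.isOpen_ball _ d.toPseudoMetricSpace h ε using 1
  ext f
  exact iff_of_eq (congrArg (· < ε) (hdist f h).symm)

theorem mem_compactOpenBall_self {X : Type*} [MetricSpace X] {M : ℕ → Set X}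
    (hM : IsCompactCover M) (h : C(X, X)) {ε : ℝ} (hε : 0 < ε) : h ∈ compactOpenBall M h ε := by
  obtain ⟨d, -, hdist⟩ := compactOpenDist_metrizes hM
  change compactOpenDist M h h < ε
  rw [← hdist]
  exact (d.dist_self h).trans_lt hε

theorem compactOpenBall_of_homeomorph {m : ℕ} (hm : 1 ≤ m) {X : Type*} [MetricSpace X]
    (e : X ≃ₜ (Fin m → ℝ)) {M : ℕ → Set X} (hM : IsCompactCover M) :
    (∀ (h : C(X, X)) (ε : ℝ), 0 < ε →
      ∃ f ∈ compactOpenBall M h ε, ¬ ∃ g : X → X, g^[2] = f) ∧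
    ¬ ∃ (h : C(X, X)) (ε : ℝ), 0 < ε ∧ compactOpenBall M h ε ⊆ iteratePowers 2 X := by
  have key : ∀ (h : C(X, X)) (ε : ℝ), 0 < ε →
      ∃ f ∈ compactOpenBall M h ε, ¬ ∃ g : X → X, g^[2] = f := fun h ε hε =>
    exists_mem_not_exists_iterate_two_eq hm e (isOpen_compactOpenBall hM h ε)
      (mem_compactOpenBall_self hM h hε)
  refine ⟨key, fun ⟨h, ε, hε, hsub⟩ => ?_⟩
  obtain ⟨f, hf, hroot⟩ := key h ε hε
  obtain ⟨g, hg⟩ := hsub hf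
  exact hroot ⟨g, hg⟩

end Density

end SelfMap

theorem mainTheorem2 (m : ℕ) (hm : 1 ≤ m) :
    -- the space `ℝ^m` with the maximum norm and the metric `D`
    (∀ M : ℕ → Set (Fin m → ℝ), SelfMap.IsCompactCover M →
      (∀ (h : C(Fin m → ℝ, Fin m → ℝ)) (ε : ℝ), 0 < ε →
        ∃ f ∈ SelfMap.compactOpenBall M h ε,
          ¬ ∃ g : (Fin m → ℝ) → (Fin m → ℝ), g^[2] = f) ∧
      ¬ ∃ (h : C(Fin m → ℝ, Fin m → ℝ)) (ε : ℝ), 0 < ε ∧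
        SelfMap.compactOpenBall M h ε ⊆ SelfMap.iteratePowers 2 (Fin m → ℝ)) ∧
    -- topological spaces homeomorphic to `ℝ^m`, with the compact-open topology
    (∀ (X : Type u) [TopologicalSpace X], Nonempty (X ≃ₜ (Fin m → ℝ)) →
      (∀ (h : C(X, X)) (U : Set C(X, X)), IsOpen U → h ∈ U →
        ∃ f ∈ U, ¬ ∃ g : X → X, g^[2] = f) ∧
      ¬ ∃ U : Set C(X, X), IsOpen U ∧ U.Nonempty ∧ U ⊆ SelfMap.iteratePowers 2 X) ∧
    -- metric spaces homeomorphic to `ℝ^m`, with the metric `D`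
    (∀ (X : Type u) [MetricSpace X], Nonempty (X ≃ₜ (Fin m → ℝ)) →
      ∀ M : ℕ → Set X, SelfMap.IsCompactCover M →
        (∀ (h : C(X, X)) (ε : ℝ), 0 < ε →
          ∃ f ∈ SelfMap.compactOpenBall M h ε, ¬ ∃ g : X → X, g^[2] = f) ∧
        ¬ ∃ (h : C(X, X)) (ε : ℝ), 0 < ε ∧
          SelfMap.compactOpenBall M h ε ⊆ SelfMap.iteratePowers 2 X) := by
  refine ⟨fun M hM => SelfMap.compactOpenBall_of_homeomorph hm (Homeomorph.refl _) hM, ?_,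
    fun X _ ⟨e⟩ M hM => SelfMap.compactOpenBall_of_homeomorph hm e hM⟩
  rintro X _ ⟨e⟩
  refine ⟨fun h U hU hh => SelfMap.exists_mem_not_exists_iterate_two_eq hm e hU hh, ?_⟩
  rintro ⟨U, hU, ⟨h, hh⟩, hsub⟩
  obtain ⟨f, hf, hroot⟩ := SelfMap.exists_mem_not_exists_iterate_two_eq hm e hU hh
  obtain ⟨g, hg⟩ := hsub hf
  exact hroot ⟨g, hg⟩
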